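/- Let $K$ be a field and let $D_H$ be a weighted oriented graph on a finite vertex set $V$, i.e. a simple graph $H$ on $V$ each of whose edges is given exactly one direction, written $(u,v)$ if it is directed from $u$ to $v$, together with a weight function $w:V\to\mathbb N\setminus\{0\}$. The edge ideal of a weighted oriented graph $D$ is the ideal $I(D)$ generated by the monomials $x_u x_v^{w(v)}$, $(u,v)\in E(D)$, in the polynomial ring $A_D$ over $K$ whose variables $x_v$ are indexed by the vertices $v$ of $D$ (we write $v$ for $x_v$). The graph $D$ is called Cohen–Macaulay (over $K$) if $A_D/I(D)$ is Cohen–Macaulay, that is, if $\operatorname{depth}(A_D/I(D))=\dim(A_D/I(D))$, where the depth is the supremum of the lengths of the regular sequences on $A_D/I(D)$ consisting of elements of the ideal generated by all the variables. Let $z\in V$ with $w(z)=1$, and let $x_1,\dots,x_k$ be the vertices adjacent to $z$, labelled such that $(x_1,z),\dots,(x_s,z)\in E(D_H)$ and $(z,x_{s+1}),\dots,(z,x_k)\in E(D_H)$. Put $D_G=D_H\setminus\{z\}$ and $D_F=D_G\setminus\{x_1,\dots,x_k\}$, with the inherited orientations and weights, let $G$ be the underlying graph of $D_G$, and put $$J=\big\langle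 I(D_G),\,x_1,\dots,x_s,\,x_{s+1}^{w(x_{s+1})},\dots,x_k^{w(x_k)}\big\rangle\subseteq A_{D_G}.$$ Assume that 1. $\{x_1,\dots,x_k\}$ is not contained in any minimal vertex cover of $G$; 2. $\operatorname{height}(J)=\operatorname{height}(I(D_G))+1$; 3. for every vertex $v$ of $D_F$ and every $j$ with $s+1\le j\le k$ such that $v$ is adjacent to $x_j$, one has $(v,x_j)\in E(D_G)$. If $D_F$ and $D_G$ are Cohen–Macaulay, then $D_H$ is Cohen–Macaulay. -/

import Mathlib

/-- A weighted oriented graph on the vertex set `V`: every edge of a simple graph carries exactly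
one of its two directions (so there are no loops and no pairs of opposite arcs), and every vertex
carries a positive integer weight. `Arc u v` says that `(u, v)` is an edge directed from `u`
to `v`. -/
structure WeightedOrientedGraph (V : Type*) where
  Arc : V → V → Prop
  asymm : ∀ u v, Arc u v → ¬ Arc v u
  weight : V → ℕ
  weight_pos : ∀ v, 0 < weight v

namespace WeightedOrientedGraph

variable {V : Type*}

/-- The underlying simple graph. -/
def toSimpleGraph (D : WeightedOrientedGraph V) : SimpleGraph V where
  Adj u v := D.Arc u v ∨ D.Arc v u
  symm := ⟨fun _ _ h => h.symm⟩
  loopless := ⟨fun v h => h.elim (fun h' => D.asymm v v h' h') (fun h' => D.asymm v v h' h')⟩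

/-- `D.deleteVerts S` is `D ∖ S`: the vertices in `S` are removed together with all edges that meet
them; orientations and weights are inherited. -/
def deleteVerts (D : WeightedOrientedGraph V) (S : Set V) :
    WeightedOrientedGraph {v : V // v ∉ S} where
  Arc u v := D.Arc u.1 v.1
  asymm u v h := D.asymm u.1 v.1 h
  weight v := D.weight v.1
  weight_pos v := D.weight_pos v.1

/-- The edge ideal: it is generated by the monomials `x_u * x_v ^ w(v)`, one for each
edge `(u, v)`, in the polynomial ring over `K` whose variables are the vertices. -/
noncomputable def edgeIdeal (K : Type*) [Field K] (D : WeightedOrientedGraph V) : Ideal (MvPolynomial V K) :=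
  Ideal.span {f | ∃ u v, D.Arc u v ∧
    f = (MvPolynomial.X u * MvPolynomial.X v ^ D.weight v : MvPolynomial V K)}

end WeightedOrientedGraph

/-- The depth of the module `M` in the ideal `𝔪`: the supremum of the lengths of the `M`-regular
sequences of elements of `𝔪`. -/
noncomputable def depthIn {R : Type*} [CommRing R] (𝔪 : Ideal R) (M : Type*) [AddCommGroup M]
    [Module R M] : ℕ∞ :=
  ⨆ (rs : List R) (_ : (∀ r ∈ rs, r ∈ 𝔪) ∧ RingTheory.Sequence.IsRegular M rs), (rs.length : ℕ∞)

/-- The graded maximal ideal of a polynomial ring, generated by all the variables. -/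
noncomputable def varsIdeal (V K : Type*) [Field K] : Ideal (MvPolynomial V K) :=
  Ideal.span (Set.range (MvPolynomial.X : V → MvPolynomial V K))

/-- The Cohen-Macaulay property of the quotient `A / I` of a polynomial ring `A` in finitely many
variables over a field by a homogeneous proper ideal `I` (below: a monomial ideal):
`depth (A / I) = dim (A / I)`, where, as usual for graded rings, the depth is taken in the ideal
generated by the variables, and `dim` is the Krull dimension. -/
def IsCohenMacaulayQuotient {V K : Type*} [Field K] (I : Ideal (MvPolynomial V K)) : Prop :=
  ((depthIn (varsIdeal V K) (MvPolynomial V K ⧸ I) : ℕ∞) : WithBot ℕ∞) =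
    ringKrullDim (MvPolynomial V K ⧸ I)

namespace WeightedOrientedGraph

/-- `D` is Cohen-Macaulay over `K` if `A / I(D)` is. -/
def IsCohenMacaulay {V : Type*} (K : Type*) [Field K] (D : WeightedOrientedGraph V) : Prop :=
  IsCohenMacaulayQuotient (D.edgeIdeal K)

variable {V : Type*}

/-- The neighbours `x₁, …, x_k` of the vertex `z`. -/
def nbrs (D : WeightedOrientedGraph V) (z : V) : Set V := D.toSimpleGraph.neighborSet z

/-- The graph `D_G = D_H ∖ {z}`. -/
abbrev graphG (D : WeightedOrientedGraph V) (z : V) :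
    WeightedOrientedGraph {v : V // v ∉ ({z} : Set V)} :=
  D.deleteVerts {z}

/-- The graph `D_F = D_G ∖ {x₁, …, x_k}`, that is, `D_H` without `z` and its neighbours. -/
abbrev graphF (D : WeightedOrientedGraph V) (z : V) :
    WeightedOrientedGraph {v : V // v ∉ insert z (D.nbrs z)} :=
  D.deleteVerts (insert z (D.nbrs z))

/-- The ideal `J` of `K[V ∖ {z}]`: it is generated by `I(D_G)`, the variables `x` of the neighbours
of `z` with `(x, z)` an edge (these are `x₁, …, x_s`), and the powers `x ^ w(x)` for the neighbours
of `z` with `(z, x)` an edge (these are `x_{s+1}, …, x_k`). -/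
noncomputable def idealJ (K : Type*) [Field K] (D : WeightedOrientedGraph V) (z : V) :
    Ideal (MvPolynomial {v : V // v ∉ ({z} : Set V)} K) :=
  (D.graphG z).edgeIdeal K ⊔
    Ideal.span {f | ∃ x : {v : V // v ∉ ({z} : Set V)}, D.Arc x.1 z ∧
      f = (MvPolynomial.X x : MvPolynomial {v : V // v ∉ ({z} : Set V)} K)} ⊔
    Ideal.span {f | ∃ x : {v : V // v ∉ ({z} : Set V)}, D.Arc z x.1 ∧
      f = (MvPolynomial.X x ^ D.weight x.1 : MvPolynomial {v : V // v ∉ ({z} : Set V)} K)}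

end WeightedOrientedGraph

/-! Write `A` for the polynomial ring on all vertices, `L = I(D_H)`, `G = I(D_G)`, and `d = dim
A_{D_G}/G`. Since `w(z) = 1`, every generator of `L` has degree at most one in `z`, so `L = GA +
zJA`. As `z` is a nonzerodivisor modulo `GA` and `G ≤ J`, this gives `L : z = JA` and `L + (z) = GA
+ (z)`, hence an exact sequence `0 → A/JA → A/L → A/(L + (z)) → 0`, whose first map is
multiplication by `z`.

The right-hand term is `A_{D_G}/G`, so it has depth and dimension `d`. On the left, the orientation
hypothesis splits `J` as `I(D_F) + Q` in disjoint sets of variables, where `Q` contains a power of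
each neighbour of `z`. Thus `A_{D_G}/J` is a tensor product over `K` of `A_{D_F}/I(D_F)` with a ring
of dimension zero. A regular sequence for `D_F`, of length `e = dim A_{D_F}/I(D_F)`, stays regular
by flatness, and `z` extends it to one of length `e + 1` on `A/JA`. The height hypothesis gives `dim
A_{D_G}/J = d - 1`, and this is at most `e`, so `d ≤ e + 1`.

Both outer terms therefore have regular sequences of length `d`, and the depth lemma
(`HasRegularSequence.of_colon`) gives one on `A/L`. Conversely `(L + (z)) * JA ≤ L`, and both
factors have quotients of dimension at most `d`, so `dim A/L ≤ d`. -/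

section RegularSequences

open CategoryTheory Abelian RingTheory.Sequence Pointwise

/-- There is an `M`-regular sequence of length `n` in the ideal `𝔪`. -/
def HasRegularSequence {R : Type*} [CommRing R] (𝔪 : Ideal R) (M : Type*) [AddCommGroup M]
    [Module R M] (n : ℕ) : Prop :=
  ∃ rs : List R, rs.length = n ∧ (∀ r ∈ rs, r ∈ 𝔪) ∧ IsRegular M rs

/-! ### Regular sequences, Ext and the depth lemma -/

section Depth

universe u

variable {R : Type u} [CommRing R]

lemma smul_top_quotient_lt_top {𝔪 I : Ideal R} (hI : I ≤ 𝔪) (h𝔪 : 𝔪 ≠ ⊤) :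
    𝔪 • (⊤ : Submodule R (R ⧸ I)) < ⊤ := by
  rw [lt_top_iff_ne_top]
  intro h
  apply h𝔪
  rw [Ideal.eq_top_iff_one]
  have h1 : (1 : R ⧸ I) ∈ 𝔪 • (⊤ : Submodule R (R ⧸ I)) := by
    rw [h]; exact Submodule.mem_top
  rw [Ideal.smul_top_eq_map, Submodule.restrictScalars_mem, Ideal.Quotient.algebraMap_eq,
    ← map_one (Ideal.Quotient.mk I), Ideal.mem_map_iff_of_surjective _
    Ideal.Quotient.mk_surjective] at h1
  obtain ⟨a, ha, h1⟩ := h1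
  rw [Ideal.Quotient.eq] at h1
  simpa using 𝔪.sub_mem ha (hI h1)

/-- Properness is automatic for sequences inside a proper ideal `𝔪` containing `I`, so only weak
regularity has to be transported later. -/
lemma IsWeaklyRegular.isRegular_quotient {𝔪 I : Ideal R} (hI : I ≤ 𝔪) (h𝔪 : 𝔪 ≠ ⊤) {rs : List R}
    (hrs : ∀ r ∈ rs, r ∈ 𝔪) (h : IsWeaklyRegular (R ⧸ I) rs) : IsRegular (R ⧸ I) rs := by
  refine ⟨h, fun h' => ?_⟩
  have := smul_top_quotient_lt_top hI h𝔪
  refine absurd (h'.le.trans (Submodule.smul_mono_left ?_)) this.not_ge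
  exact Ideal.span_le.mpr hrs

variable [IsNoetherianRing R]

/-- Rees' criterion; it turns depth into a condition that long exact sequences can handle. -/
lemma hasRegularSequence_iff_ext {𝔪 : Ideal R} {M : Type u} [AddCommGroup M] [Module R M]
    [Module.Finite R M] (hM : 𝔪 • (⊤ : Submodule R M) < ⊤) (n : ℕ) :
    HasRegularSequence 𝔪 M n ↔
      ∀ i < n, Subsingleton (Ext (ModuleCat.of R (Shrink.{u} (R ⧸ 𝔪))) (ModuleCat.of R M) i) :=
  (ModuleCat.exists_isRegular_tfae 𝔪 n (ModuleCat.of R M) hM).out 3 1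

lemma HasRegularSequence.mono {𝔪 : Ideal R} {M : Type u} [AddCommGroup M] [Module R M]
    [Module.Finite R M] (hM : 𝔪 • (⊤ : Submodule R M) < ⊤) {m n : ℕ} (hmn : m ≤ n)
    (h : HasRegularSequence 𝔪 M n) : HasRegularSequence 𝔪 M m := by
  rw [hasRegularSequence_iff_ext hM] at h ⊢
  exact fun i hi => h i (hi.trans_le hmn)

/-- In the long exact sequence, each `Ext` group of the middle module sits between two groups that
vanish below degree `n`. -/
lemma HasRegularSequence.of_exact {𝔪 : Ideal R} {M₁ M₂ M₃ : Type u}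
    [AddCommGroup M₁] [Module R M₁] [Module.Finite R M₁]
    [AddCommGroup M₂] [Module R M₂] [Module.Finite R M₂]
    [AddCommGroup M₃] [Module R M₃] [Module.Finite R M₃]
    (h₁ : 𝔪 • (⊤ : Submodule R M₁) < ⊤) (h₂ : 𝔪 • (⊤ : Submodule R M₂) < ⊤)
    (h₃ : 𝔪 • (⊤ : Submodule R M₃) < ⊤) (f : M₁ →ₗ[R] M₂) (g : M₂ →ₗ[R] M₃)
    (hf : Function.Injective f) (hfg : Function.Exact f g) (hg : Function.Surjective g) {n : ℕ}
    (hn₁ : HasRegularSequence 𝔪 M₁ n) (hn₃ : HasRegularSequence 𝔪 M₃ n) :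
    HasRegularSequence 𝔪 M₂ n := by
  rw [hasRegularSequence_iff_ext h₁] at hn₁
  rw [hasRegularSequence_iff_ext h₃] at hn₃
  rw [hasRegularSequence_iff_ext h₂]
  intro i hi
  let S : ShortComplex (ModuleCat.{u} R) :=
    ShortComplex.mk (ModuleCat.ofHom f) (ModuleCat.ofHom g) (by
      ext x; simpa using hfg.apply_apply_eq_zero x)
  have hS : S.ShortExact :=
    { exact := (ShortComplex.ShortExact.moduleCat_exact_iff_function_exact S).mpr hfg
      mono_f := (ModuleCat.mono_iff_injective _).mpr hf
      epi_g := (ModuleCat.epi_iff_surjective _).mpr hg }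
  have e₁ := AddCommGrpCat.isZero_of_iff_subsingleton.mpr (hn₁ i hi)
  have e₃ := AddCommGrpCat.isZero_of_iff_subsingleton.mpr (hn₃ i hi)
  exact AddCommGrpCat.subsingleton_of_isZero <| ShortComplex.Exact.isZero_of_both_zeros
    (Ext.covariant_sequence_exact₂' _ hS i) (e₁.eq_zero_of_src _) (e₃.eq_zero_of_tgt _)

/-- The depth lemma for `0 → R/J → R/L → R/(L + (x)) → 0`. Multiplication by `x` is well defined and
injective exactly because `J = L : x`. -/
lemma HasRegularSequence.of_colon {𝔪 L J : Ideal R} {x : R} (h𝔪 : 𝔪 ≠ ⊤) (hL : L ≤ 𝔪)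
    (hJ : J ≤ 𝔪) (hx : x ∈ 𝔪) (hcolon : ∀ f, x * f ∈ L ↔ f ∈ J) {n : ℕ}
    (hn₁ : HasRegularSequence 𝔪 (R ⧸ J) n)
    (hn₃ : HasRegularSequence 𝔪 (R ⧸ (L ⊔ Ideal.span {x})) n) :
    HasRegularSequence 𝔪 (R ⧸ L) n := by
  have hC : L ⊔ Ideal.span {x} ≤ 𝔪 := sup_le hL ((Ideal.span_singleton_le_iff_mem _).mpr hx)
  let f : (R ⧸ J) →ₗ[R] (R ⧸ L) :=
    Submodule.mapQ J L (LinearMap.lsmul R R x) (fun a ha => (hcolon a).mpr ha)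
  let g : (R ⧸ L) →ₗ[R] (R ⧸ (L ⊔ Ideal.span {x})) := Submodule.factor le_sup_left
  have hJ' := smul_top_quotient_lt_top hJ h𝔪
  have hL' := smul_top_quotient_lt_top hL h𝔪
  have hC' := smul_top_quotient_lt_top hC h𝔪
  refine HasRegularSequence.of_exact hJ' hL' hC' f g ?_ ?_ ?_ hn₁ hn₃
  · rw [← LinearMap.ker_eq_bot, LinearMap.ker_eq_bot']
    intro m hm
    obtain ⟨a, rfl⟩ := Submodule.Quotient.mk_surjective _ m
    have : (Submodule.Quotient.mk (x * a) : R ⧸ L) = 0 := hm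
    rw [Submodule.Quotient.mk_eq_zero] at this ⊢
    exact (hcolon a).mp this
  · intro m
    obtain ⟨a, rfl⟩ := Submodule.Quotient.mk_surjective _ m
    have hga : g (Submodule.Quotient.mk a) = Submodule.Quotient.mk a := rfl
    rw [hga, Submodule.Quotient.mk_eq_zero]
    constructor
    · intro ha
      obtain ⟨l, hl, y, hy, rfl⟩ := Submodule.mem_sup.mp ha
      obtain ⟨b, rfl⟩ := Ideal.mem_span_singleton'.mp hy
      refine ⟨Submodule.Quotient.mk b, ?_⟩
      change (Submodule.Quotient.mk (x * b) : R ⧸ L) = _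
      rw [Submodule.Quotient.eq]
      have : x * b - (l + b * x) = -l := by ring
      rw [this]; exact L.neg_mem hl
    · rintro ⟨m, hm⟩
      obtain ⟨b, rfl⟩ := Submodule.Quotient.mk_surjective _ m
      have hm : (Submodule.Quotient.mk (x * b) : R ⧸ L) = Submodule.Quotient.mk a := hm
      rw [Submodule.Quotient.eq] at hm
      have : a = -(x * b - a) + x * b := by ring
      rw [this]
      exact add_mem (Ideal.mem_sup_left (L.neg_mem hm))
        (Ideal.mem_sup_right (Ideal.mul_mem_right _ _ (Ideal.mem_span_singleton_self x)))
  · exact Submodule.factor_surjective _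

end Depth

/-! ### Depth is at most dimension -/

section QuotSMulTop

variable {R : Type*} [CommRing R]

/-- The quotient of `R ⧸ I` by the image of multiplication by `r` is `R ⧸ (I + (r))`. -/
noncomputable def quotSMulTopQuotientEquiv (I : Ideal R) (r : R) :
    QuotSMulTop r (R ⧸ I) ≃ₗ[R] R ⧸ (I ⊔ Ideal.span {r}) :=
  Submodule.quotEquivOfEq _ _ (by
    rw [← Submodule.ideal_span_singleton_smul, ← Submodule.range_mkQ I,
      LinearMap.range_eq_map, ← Submodule.map_smul'', smul_eq_mul, Ideal.mul_top]) ≪≫ₗ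
    Submodule.quotientQuotientEquivQuotientSup I (Ideal.span {r})

/-- Induction on the sequence: dividing by a nonzerodivisor lowers the dimension by at least one. -/
lemma length_le_ringKrullDim_of_isRegular (I : Ideal R) (rs : List R)
    (h : IsRegular (R ⧸ I) rs) : (rs.length : WithBot ℕ∞) ≤ ringKrullDim (R ⧸ I) := by
  induction rs generalizing I with
  | nil =>
    have := h.nontrivial
    simpa using ringKrullDim_nonneg_of_nontrivial
  | cons r rs ih =>
    rw [isRegular_cons_iff, (quotSMulTopQuotientEquiv I r).isRegular_congr] at h
    have h₁ := ih _ h.2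
    have h₂ : ringKrullDim (R ⧸ (I ⊔ Ideal.span {r})) + 1 ≤ ringKrullDim (R ⧸ I) := by
      refine ringKrullDim_succ_le_of_surjective (Ideal.Quotient.factor le_sup_left)
        (Ideal.Quotient.factor_surjective _) (r := Ideal.Quotient.mk I r) ?_ ?_
      · rw [mem_nonZeroDivisors_iff_right]
        intro x hx
        refine h.1.right_eq_zero_of_smul (x := x) ?_
        rw [mul_comm] at hx
        rw [← hx, Algebra.smul_def, Ideal.Quotient.algebraMap_eq]
      · rw [Ideal.Quotient.factor_mk, Ideal.Quotient.eq_zero_iff_mem]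
        exact Ideal.mem_sup_right (Ideal.mem_span_singleton_self r)
    refine le_trans ?_ h₂
    push_cast [List.length_cons]
    gcongr

end QuotSMulTop

/-! ### Cohen–Macaulay quotients in terms of regular sequences -/

section CohenMacaulay

variable {V K : Type*} [Field K] {I : Ideal (MvPolynomial V K)}

lemma varsIdeal_le_ker :
    varsIdeal V K ≤ RingHom.ker (MvPolynomial.constantCoeff (σ := V) (R := K)) := by
  rw [varsIdeal, Ideal.span_le]
  rintro _ ⟨v, rfl⟩
  simp [RingHom.mem_ker]

lemma varsIdeal_ne_top : varsIdeal V K ≠ ⊤ :=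
  ne_top_of_le_ne_top (RingHom.ker_ne_top _) varsIdeal_le_ker

lemma X_mem_varsIdeal (v : V) : (MvPolynomial.X v : MvPolynomial V K) ∈ varsIdeal V K :=
  Ideal.subset_span ⟨v, rfl⟩

/-- The dimension is bounded by the number of variables, so the supremum defining the depth is
finite and attained. -/
lemma IsCohenMacaulayQuotient.exists_hasRegularSequence [Finite V] (hI : I ≤ varsIdeal V K)
    (h : IsCohenMacaulayQuotient I) :
    ∃ n : ℕ, ringKrullDim (MvPolynomial V K ⧸ I) = n ∧
      HasRegularSequence (varsIdeal V K) (MvPolynomial V K ⧸ I) n := by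
  have hle : ringKrullDim (MvPolynomial V K ⧸ I) ≤ (Nat.card V : ℕ) := by
    refine (ringKrullDim_quotient_le I).trans ?_
    simp [MvPolynomial.ringKrullDim_of_isNoetherianRing, ringKrullDim_eq_zero_of_field]
  have hnt : Nontrivial (MvPolynomial V K ⧸ I) :=
    Ideal.Quotient.nontrivial_iff.mpr (ne_top_of_le_ne_top varsIdeal_ne_top hI)
  obtain ⟨n, hn⟩ : ∃ n : ℕ, depthIn (varsIdeal V K) (MvPolynomial V K ⧸ I) = n := by
    rw [← h] at hle
    obtain ⟨n, hn, -⟩ := ENat.le_natCast_iff.mp (WithBot.coe_le_coe.mp hle)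
    exact ⟨n, hn⟩
  refine ⟨n, by rw [← h, hn]; rfl, ?_⟩
  rcases Nat.eq_zero_or_pos n with rfl | hpos
  · exact ⟨[], rfl, by simp, IsRegular.nil _ _⟩
  · have hlt : ((n - 1 : ℕ) : ℕ∞) < depthIn (varsIdeal V K) (MvPolynomial V K ⧸ I) := by
      rw [hn]; exact_mod_cast Nat.sub_lt hpos one_pos
    simp only [depthIn, lt_iSup_iff] at hlt
    obtain ⟨rs, hrs, hlt⟩ := hlt
    have hlt' := smul_top_quotient_lt_top hI varsIdeal_ne_top
    refine HasRegularSequence.mono hlt' ?_ ⟨rs, rfl, hrs⟩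
    have : n - 1 < rs.length := by exact_mod_cast hlt
    omega

lemma IsCohenMacaulayQuotient.of_hasRegularSequence {n : ℕ}
    (hdim : ringKrullDim (MvPolynomial V K ⧸ I) ≤ n)
    (h : HasRegularSequence (varsIdeal V K) (MvPolynomial V K ⧸ I) n) :
    IsCohenMacaulayQuotient I := by
  obtain ⟨rs, rfl, hrs⟩ := h
  have h₁ : (rs.length : ℕ∞) ≤ depthIn (varsIdeal V K) (MvPolynomial V K ⧸ I) :=
    le_iSup₂_of_le rs hrs le_rfl
  have h₂ : depthIn (varsIdeal V K) (MvPolynomial V K ⧸ I) ≤ rs.length := by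
    refine iSup₂_le fun ss hss => ?_
    exact_mod_cast (length_le_ringKrullDim_of_isRegular I ss hss.2).trans hdim
  rw [IsCohenMacaulayQuotient, le_antisymm h₂ h₁]
  exact le_antisymm (length_le_ringKrullDim_of_isRegular I rs hrs.2) hdim

end CohenMacaulay

end RegularSequences

/-! ### Dimension of quotients: products and heights -/

section KrullDim

variable {R : Type*} [CommRing R]

/-- The smallest prime of a chain above `I` contains `I₁` or `I₂`, and then so does the whole chain.
-/
lemma ringKrullDim_quotient_le_of_mul_le {I I₁ I₂ : Ideal R} (h : I₁ * I₂ ≤ I) {n : WithBot ℕ∞}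
    (h₁ : ringKrullDim (R ⧸ I₁) ≤ n) (h₂ : ringKrullDim (R ⧸ I₂) ≤ n) :
    ringKrullDim (R ⧸ I) ≤ n := by
  have key : ∀ (J : Ideal R) (s : LTSeries (PrimeSpectrum.zeroLocus (R := R) I)),
      J ≤ s.head.1.asIdeal → ringKrullDim (R ⧸ J) ≤ n → (s.length : WithBot ℕ∞) ≤ n := by
    intro J s hs hJ
    rw [ringKrullDim_quotient] at hJ
    let t : LTSeries (PrimeSpectrum.zeroLocus (R := R) J) :=
      { length := s.length
        toFun := fun i => ⟨(s i).1, hs.trans (s.head_le i)⟩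
        step := fun i => s.step i }
    exact (Order.LTSeries.length_le_krullDim t).trans hJ
  rw [ringKrullDim_quotient, Order.krullDim]
  refine iSup_le fun s => ?_
  have hs : I ≤ s.head.1.asIdeal := s.head.2
  rcases s.head.1.isPrime.mul_le.mp (h.trans hs) with h' | h'
  · exact key _ s h' h₁
  · exact key _ s h' h₂

/-- In a chain of primes above `I`, the `i`-th one has height at least `i + I.height`. -/
lemma ringKrullDim_quotient_add_height_le (I : Ideal R) [Nontrivial (R ⧸ I)] :
    ringKrullDim (R ⧸ I) + I.height ≤ ringKrullDim R := by
  have hI : I ≠ ⊤ := Ideal.Quotient.nontrivial_iff.mp ‹_›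
  have key (s : LTSeries (PrimeSpectrum.zeroLocus (R := R) I)) :
      ((s.length : ℕ∞) + I.height : ℕ∞) ≤ ringKrullDim R := by
    have h (i : Fin (s.length + 1)) :
        ((i : ℕ) : ℕ∞) + I.height ≤ (s i).1.asIdeal.height := by
      induction i using Fin.induction with
      | zero => simpa using Ideal.height_mono (s 0).2
      | succ i ih =>
        have hlt : (s i.castSucc).1.asIdeal < (s i.succ).1.asIdeal := s.step i
        have := Ideal.height_add_one_le_of_lt_of_isPrime hlt
        refine le_trans ?_ this
        refine le_trans (le_of_eq ?_) (add_le_add_left ih 1)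
        simp only [Fin.val_succ, Fin.val_castSucc, Nat.cast_add, Nat.cast_one]
        abel
    refine le_trans (WithBot.coe_le_coe.mpr (h (Fin.last _))) ?_
    exact Ideal.height_le_ringKrullDim_of_isPrime
  have : Nonempty (PrimeSpectrum.zeroLocus (R := R) I) := by
    obtain ⟨P, hP, hIP⟩ := Ideal.exists_le_maximal I hI
    exact ⟨⟨⟨P, hP.isPrime⟩, hIP⟩⟩
  rw [ringKrullDim_quotient, Order.krullDim_eq_iSup_length, ← WithBot.coe_add, ENat.iSup_add]
  have hR : Nontrivial R := (Ideal.Quotient.mk I).domain_nontrivial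
  obtain ⟨m, hm⟩ : ∃ m : ℕ∞, (m : WithBot ℕ∞) = ringKrullDim R :=
    WithBot.ne_bot_iff_exists.mp (ne_bot_of_le_ne_bot (by simp) ringKrullDim_nonneg_of_nontrivial)
  rw [← hm] at key ⊢
  exact WithBot.coe_le_coe.mpr (iSup_le fun s => WithBot.coe_le_coe.mp (key s))

end KrullDim

/-! ### Ideals generated by variables and the dimension formula -/

section Vars

open MvPolynomial

variable {σ K : Type*} [Field K]

open Classical in
/-- The substitution that sets the variables in `C` equal to zero. -/
noncomputable def killVars (K : Type*) [Field K] (C : Set σ) :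
    MvPolynomial σ K →ₐ[K] MvPolynomial σ K :=
  aeval fun v => if v ∈ C then 0 else X v

lemma ker_killVars (C : Set σ) :
    RingHom.ker (killVars K C) = Ideal.span (X '' C : Set (MvPolynomial σ K)) := by
  apply le_antisymm
  · intro f hf
    have h : ((Ideal.Quotient.mkₐ K (Ideal.span (X '' C : Set (MvPolynomial σ K)))).comp
        (killVars K C)) = Ideal.Quotient.mkₐ K _ := by
      ext v
      by_cases hv : v ∈ C
      · have : (X v : MvPolynomial σ K) ∈ Ideal.span (X '' C : Set (MvPolynomial σ K)) :=
          Ideal.subset_span ⟨v, hv, rfl⟩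
        simpa [killVars, hv] using (Ideal.Quotient.eq_zero_iff_mem.mpr this).symm
      · simp [killVars, hv]
    have h' := DFunLike.congr_fun h f
    rw [AlgHom.comp_apply, (RingHom.mem_ker).mp hf, map_zero] at h'
    exact Ideal.Quotient.eq_zero_iff_mem.mp h'.symm
  · rw [Ideal.span_le]
    rintro _ ⟨v, hv, rfl⟩
    simp [killVars, hv, RingHom.mem_ker]

instance isPrime_span_X_image (C : Set σ) :
    (Ideal.span (X '' C : Set (MvPolynomial σ K))).IsPrime := by
  rw [← ker_killVars]
  exact RingHom.ker_isPrime _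

lemma X_mem_span_X_image {C : Set σ} {v : σ} :
    (X v : MvPolynomial σ K) ∈ Ideal.span (X '' C : Set (MvPolynomial σ K)) ↔ v ∈ C := by
  rw [← ker_killVars, RingHom.mem_ker]
  by_cases hv : v ∈ C <;> simp [killVars, hv, X_ne_zero]

/-- Adjoining the variables one at a time gives a strictly increasing chain of primes. -/
lemma card_le_height_span_X_image (C : Finset σ) :
    (C.card : ℕ∞) ≤ (Ideal.span (X '' (C : Set σ) : Set (MvPolynomial σ K))).height := by
  classical
  induction C using Finset.induction with
  | empty => simp
  | insert a C ha ih =>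
    rw [Finset.card_insert_of_notMem ha]
    push_cast
    refine (add_le_add_left ih 1).trans (Ideal.height_add_one_le_of_lt_of_isPrime ?_)
    refine lt_of_le_of_ne (Ideal.span_mono (Set.image_mono (by simp))) fun h => ha ?_
    have : (X a : MvPolynomial σ K) ∈
        Ideal.span (X '' ((insert a C : Finset σ) : Set σ) : Set (MvPolynomial σ K)) :=
      X_mem_span_X_image.mpr (by simp)
    rw [Finset.coe_insert, ← h] at this
    simpa using X_mem_span_X_image.mp this

/-- Take a prime `P ≥ I` with the height of `I`, and let `C` be the set of variables in `P`. Then `I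
≤ (C) ≤ P`, so `|C| ≤ I.height`, while dividing by `|C|` variables lowers the dimension by at most
`|C|`. -/
lemma card_le_ringKrullDim_add_height [Finite σ] {I : Ideal (MvPolynomial σ K)} (hI : I ≠ ⊤)
    (h : ∀ P : Ideal (MvPolynomial σ K), P.IsPrime → I ≤ P →
      I ≤ Ideal.span (X '' {v | (X v : MvPolynomial σ K) ∈ P})) :
    (Nat.card σ : WithBot ℕ∞) ≤ ringKrullDim (MvPolynomial σ K ⧸ I) + I.height := by
  classical
  have := Fintype.ofFinite σ
  obtain ⟨P, hP, hIP, hPI⟩ : ∃ P : Ideal (MvPolynomial σ K), ∃ (_ : P.IsPrime) (_ : I ≤ P), P.height = I.height := by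
    obtain ⟨n, hn⟩ := ENat.ne_top_iff_exists.mp (Ideal.height_ne_top hI)
    rw [← hn]
    exact Ideal.exists_isPrime_height_eq hn.symm
  set C : Finset σ := {v | (X v : MvPolynomial σ K) ∈ P} with hC
  have hCP : Ideal.span (X '' (C : Set σ)) ≤ P := by
    rw [Ideal.span_le]; rintro _ ⟨v, hv, rfl⟩; simpa [hC] using hv
  have hIC : I ≤ Ideal.span (X '' (C : Set σ)) := by
    simpa [hC] using h P hP hIP
  have h₁ : (C.card : ℕ∞) ≤ I.height :=
    hPI ▸ (card_le_height_span_X_image C).trans (Ideal.height_mono hCP)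
  have h₂ : ringKrullDim (MvPolynomial σ K ⧸
      Ideal.span (X '' (C : Set σ) : Set (MvPolynomial σ K))) ≤
      ringKrullDim (MvPolynomial σ K ⧸ I) :=
    ringKrullDim_le_of_surjective (Ideal.Quotient.factor hIC) (Ideal.Quotient.factor_surjective _)
  -- Applied to the ideal of all variables, whose height is at least the number of variables.
  have h₃ := Ideal.height_le_ringKrullDim_quotient_add_encard
    (p := Ideal.span (X '' ((Finset.univ : Finset σ) : Set σ) : Set (MvPolynomial σ K)))
    (X '' (C : Set σ)) ((Set.image_mono (by simp)).trans Ideal.subset_span)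
  have h₄ := card_le_height_span_X_image (K := K) (Finset.univ : Finset σ)
  rw [Finset.card_univ, ← Nat.card_eq_fintype_card] at h₄
  have h₅ : (X '' (C : Set σ) : Set (MvPolynomial σ K)).encard ≤ C.card := by
    simpa using Set.encard_image_le (X : σ → MvPolynomial σ K) (C : Set σ)
  calc (Nat.card σ : WithBot ℕ∞) ≤ _ := WithBot.coe_le_coe.mpr h₄
    _ ≤ _ := h₃
    _ ≤ _ := add_le_add h₂ (WithBot.coe_le_coe.mpr (h₅.trans h₁))

end Vars

/-! ### Quotients in disjoint variables, and adjoining one variable -/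

section PolynomialExtensions

open RingTheory.Sequence TensorProduct Pointwise
open MvPolynomial

section TensorProduct

variable {K α β σ : Type*} [Field K]

/-- The map from a polynomial ring in the disjoint union of two sets of variables to the tensor
product of quotients of the polynomial rings in these sets of variables. -/
noncomputable def toTensorQuotient (e : α ⊕ β ≃ σ) (I : Ideal (MvPolynomial α K))
    (Q : Ideal (MvPolynomial β K)) :
    MvPolynomial σ K →ₐ[K] (MvPolynomial α K ⧸ I) ⊗[K] (MvPolynomial β K ⧸ Q) :=
  aeval fun s => Sum.elim
    (fun i => Ideal.Quotient.mk I (X i) ⊗ₜ[K] (1 : MvPolynomial β K ⧸ Q))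
    (fun j => (1 : MvPolynomial α K ⧸ I) ⊗ₜ[K] Ideal.Quotient.mk Q (X j)) (e.symm s)

lemma toTensorQuotient_rename_inl (e : α ⊕ β ≃ σ) (I : Ideal (MvPolynomial α K))
    (Q : Ideal (MvPolynomial β K)) (f : MvPolynomial α K) :
    toTensorQuotient e I Q (rename (e ∘ Sum.inl) f) = Ideal.Quotient.mk I f ⊗ₜ[K] 1 := by
  have : (toTensorQuotient e I Q).comp (rename (e ∘ Sum.inl)) =
      Algebra.TensorProduct.includeLeft.comp (Ideal.Quotient.mkₐ K I) := by
    ext i; simp [toTensorQuotient]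
  exact DFunLike.congr_fun this f

lemma toTensorQuotient_rename_inr (e : α ⊕ β ≃ σ) (I : Ideal (MvPolynomial α K))
    (Q : Ideal (MvPolynomial β K)) (f : MvPolynomial β K) :
    toTensorQuotient e I Q (rename (e ∘ Sum.inr) f) = 1 ⊗ₜ[K] Ideal.Quotient.mk Q f := by
  have : (toTensorQuotient e I Q).comp (rename (e ∘ Sum.inr)) =
      Algebra.TensorProduct.includeRight.comp (Ideal.Quotient.mkₐ K Q) := by
    ext i; simp [toTensorQuotient]
  exact DFunLike.congr_fun this f

lemma toTensorQuotient_X_inl (e : α ⊕ β ≃ σ) (I : Ideal (MvPolynomial α K))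
    (Q : Ideal (MvPolynomial β K)) (i : α) :
    toTensorQuotient e I Q (X (e (Sum.inl i))) = Ideal.Quotient.mk I (X i) ⊗ₜ[K] 1 := by
  simp [toTensorQuotient]

lemma toTensorQuotient_X_inr (e : α ⊕ β ≃ σ) (I : Ideal (MvPolynomial α K))
    (Q : Ideal (MvPolynomial β K)) (j : β) :
    toTensorQuotient e I Q (X (e (Sum.inr j))) = 1 ⊗ₜ[K] Ideal.Quotient.mk Q (X j) := by
  simp [toTensorQuotient]

lemma sup_map_rename_le_ker (e : α ⊕ β ≃ σ) (I : Ideal (MvPolynomial α K))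
    (Q : Ideal (MvPolynomial β K)) :
    I.map (rename (R := K) (e ∘ Sum.inl)) ⊔ Q.map (rename (R := K) (e ∘ Sum.inr)) ≤
      RingHom.ker (toTensorQuotient e I Q) := by
  rw [sup_le_iff, Ideal.map_le_iff_le_comap, Ideal.map_le_iff_le_comap]
  constructor
  · intro f hf
    rw [Ideal.mem_comap, RingHom.mem_ker, toTensorQuotient_rename_inl,
      Ideal.Quotient.eq_zero_iff_mem.mpr hf, TensorProduct.zero_tmul]
  · intro f hf
    rw [Ideal.mem_comap, RingHom.mem_ker, toTensorQuotient_rename_inr,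
      Ideal.Quotient.eq_zero_iff_mem.mpr hf, TensorProduct.tmul_zero]

/-- The inverse direction of `quotientSupEquivTensor`. -/
noncomputable def ofTensorQuotient (e : α ⊕ β ≃ σ) (I : Ideal (MvPolynomial α K))
    (Q : Ideal (MvPolynomial β K)) :
    (MvPolynomial α K ⧸ I) ⊗[K] (MvPolynomial β K ⧸ Q) →ₐ[K]
      (MvPolynomial σ K ⧸ (I.map (rename (R := K) (e ∘ Sum.inl)) ⊔
        Q.map (rename (R := K) (e ∘ Sum.inr)))) :=
  Algebra.TensorProduct.lift
    (Ideal.quotientMapₐ _ (rename (e ∘ Sum.inl)) (Ideal.map_le_iff_le_comap.mp le_sup_left))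
    (Ideal.quotientMapₐ _ (rename (e ∘ Sum.inr)) (Ideal.map_le_iff_le_comap.mp le_sup_right))
    (fun _ _ => Commute.all _ _)

lemma ofTensorQuotient_X_inl (e : α ⊕ β ≃ σ) (I : Ideal (MvPolynomial α K))
    (Q : Ideal (MvPolynomial β K)) (i : α) :
    ofTensorQuotient e I Q (Ideal.Quotient.mk I (X i) ⊗ₜ[K] 1) =
      Ideal.Quotient.mk _ (X (e (Sum.inl i))) := by
  simp [ofTensorQuotient]

lemma ofTensorQuotient_X_inr (e : α ⊕ β ≃ σ) (I : Ideal (MvPolynomial α K))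
    (Q : Ideal (MvPolynomial β K)) (j : β) :
    ofTensorQuotient e I Q (1 ⊗ₜ[K] Ideal.Quotient.mk Q (X j)) =
      Ideal.Quotient.mk _ (X (e (Sum.inr j))) := by
  simp [ofTensorQuotient]

/-- The quotient of a polynomial ring by the sum of two ideals in disjoint sets of variables is a
tensor product. -/
noncomputable def quotientSupEquivTensor (e : α ⊕ β ≃ σ) (I : Ideal (MvPolynomial α K))
    (Q : Ideal (MvPolynomial β K)) :
    (MvPolynomial σ K ⧸ (I.map (rename (R := K) (e ∘ Sum.inl)) ⊔
      Q.map (rename (R := K) (e ∘ Sum.inr)))) ≃ₐ[K]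
      (MvPolynomial α K ⧸ I) ⊗[K] (MvPolynomial β K ⧸ Q) :=
  AlgEquiv.ofAlgHom
    (Ideal.Quotient.liftₐ _ (toTensorQuotient e I Q) (fun _ ha => sup_map_rename_le_ker e I Q ha))
    (ofTensorQuotient e I Q)
    (by
      apply Algebra.TensorProduct.ext
      · apply Ideal.Quotient.algHom_ext
        ext i
        exact (congrArg (Ideal.Quotient.liftₐ _ (toTensorQuotient e I Q)
          (fun _ ha => sup_map_rename_le_ker e I Q ha)) (ofTensorQuotient_X_inl e I Q i)).trans
          (toTensorQuotient_X_inl e I Q i)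
      · apply Ideal.Quotient.algHom_ext
        ext i
        exact (congrArg (Ideal.Quotient.liftₐ _ (toTensorQuotient e I Q)
          (fun _ ha => sup_map_rename_le_ker e I Q ha)) (ofTensorQuotient_X_inr e I Q i)).trans
          (toTensorQuotient_X_inr e I Q i))
    (by
      apply Ideal.Quotient.algHom_ext
      ext s
      obtain ⟨s | s, rfl⟩ := e.surjective s
      · exact (congrArg (ofTensorQuotient e I Q) (toTensorQuotient_X_inl e I Q s)).trans
          (ofTensorQuotient_X_inl e I Q s)
      · exact (congrArg (ofTensorQuotient e I Q) (toTensorQuotient_X_inr e I Q s)).trans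
          (ofTensorQuotient_X_inr e I Q s))

lemma quotientSupEquivTensor_mk_rename (e : α ⊕ β ≃ σ) (I : Ideal (MvPolynomial α K))
    (Q : Ideal (MvPolynomial β K)) (f : MvPolynomial α K) :
    quotientSupEquivTensor e I Q (Ideal.Quotient.mk _ (rename (e ∘ Sum.inl) f)) =
      Ideal.Quotient.mk I f ⊗ₜ[K] 1 :=
  toTensorQuotient_rename_inl e I Q f

lemma isWeaklyRegular_quotient_sup_map_rename (e : α ⊕ β ≃ σ) (I : Ideal (MvPolynomial α K))
    (Q : Ideal (MvPolynomial β K)) {rs : List (MvPolynomial α K)}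
    (h : IsWeaklyRegular (MvPolynomial α K ⧸ I) rs) :
    IsWeaklyRegular (MvPolynomial σ K ⧸ (I.map (rename (R := K) (e ∘ Sum.inl)) ⊔
      Q.map (rename (R := K) (e ∘ Sum.inr)))) (rs.map (rename (e ∘ Sum.inl))) := by
  -- `M ⊗[K] N` is `M` tensored over `MvPolynomial α K` with the base change of `N`, which is flat
  -- because `K` is a field.
  have h₁ : IsWeaklyRegular ((MvPolynomial α K ⧸ I) ⊗[K] (MvPolynomial β K ⧸ Q)) rs :=
    ((TensorProduct.AlgebraTensorModule.cancelBaseChange K (MvPolynomial α K) (MvPolynomial α K)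
      (MvPolynomial α K ⧸ I) (MvPolynomial β K ⧸ Q)).isWeaklyRegular_congr rs).mp
      h.isWeaklyRegular_rTensor
  refine ((quotientSupEquivTensor e I Q).toAddEquiv.isWeaklyRegular_congr ?_).mpr h₁
  rw [List.forall₂_map_left_iff, List.forall₂_same]
  intro r _ x
  have hx : rename (e ∘ Sum.inl) r • x =
    Ideal.Quotient.mk _ (rename (e ∘ Sum.inl) r) * x := by
      rw [Algebra.smul_def, Ideal.Quotient.algebraMap_eq]
  rw [hx]
  refine (map_mul (quotientSupEquivTensor e I Q) _ _).trans ?_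
  rw [quotientSupEquivTensor_mk_rename]
  change _ = r • quotientSupEquivTensor e I Q x
  induction quotientSupEquivTensor e I Q x using TensorProduct.induction_on with
  | zero => 
    exact (mul_zero (Ideal.Quotient.mk I r ⊗ₜ[K] (1 : MvPolynomial β K ⧸ Q))).trans
      (smul_zero r).symm
  | add x y hx hy => rw [mul_add, hx, hy, smul_add]
  | tmul x y =>
    rw [Algebra.TensorProduct.tmul_mul_tmul, one_mul, TensorProduct.smul_tmul']
    obtain ⟨a, rfl⟩ := Ideal.Quotient.mk_surjective x
    rfl

end TensorProduct

section Extension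

variable {K V : Type*} [Field K] (z : V)

/-- The inclusion of the polynomial ring in all variables but `z`. -/
noncomputable abbrev inclVars (K : Type*) [Field K] (z : V) :
    MvPolynomial {v : V // v ∉ ({z} : Set V)} K →ₐ[K] MvPolynomial V K :=
  rename Subtype.val

open Classical in
/-- Substituting zero for `z`. -/
noncomputable def evalZero (K : Type*) [Field K] (z : V) :
    MvPolynomial V K →ₐ[K] MvPolynomial {v : V // v ∉ ({z} : Set V)} K :=
  aeval fun v => if h : v ∉ ({z} : Set V) then X ⟨v, h⟩ else 0

lemma evalZero_comp_inclVars : (evalZero K z).comp (inclVars K z) = AlgHom.id _ _ := by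
  refine MvPolynomial.algHom_ext fun v => ?_
  have := v.2
  simp only [evalZero, inclVars, AlgHom.comp_apply, rename_X, aeval_X, AlgHom.id_apply]
  exact dif_pos this

lemma evalZero_inclVars (f) : evalZero K z (inclVars K z f) = f :=
  DFunLike.congr_fun (evalZero_comp_inclVars z) f

lemma sub_mem_span_X (f : MvPolynomial V K) :
    f - inclVars K z (evalZero K z f) ∈ Ideal.span {(X z : MvPolynomial V K)} := by
  have h : ((Ideal.Quotient.mkₐ K (Ideal.span {(X z : MvPolynomial V K)})).comp
      ((inclVars K z).comp (evalZero K z))) = Ideal.Quotient.mkₐ K _ := by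
    ext v
    by_cases hv : v = z
    · subst hv
      have : (X v : MvPolynomial V K) ∈ Ideal.span {(X v : MvPolynomial V K)} :=
        Ideal.mem_span_singleton_self _
      simp [evalZero]
    · simp [evalZero, hv]
  have := DFunLike.congr_fun h f
  rw [← Ideal.Quotient.eq]
  exact this.symm

variable (I : Ideal (MvPolynomial {v : V // v ∉ ({z} : Set V)} K))

lemma inclVars_mem_sup_span_iff {f} :
    inclVars K z f ∈ I.map (inclVars K z) ⊔ Ideal.span {X z} ↔ f ∈ I := by
  refine ⟨fun h => ?_, fun h => Ideal.mem_sup_left (Ideal.mem_map_of_mem _ h)⟩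
  have hle : I.map (inclVars K z) ⊔ Ideal.span {X z} ≤ I.comap (evalZero K z) := by
    rw [sup_le_iff, Ideal.map_le_iff_le_comap, Ideal.span_le]
    constructor
    · intro f hf
      simpa only [Ideal.mem_comap, evalZero_inclVars] using hf
    · rintro _ rfl
      simp [evalZero]
  simpa only [Ideal.mem_comap, evalZero_inclVars] using hle h

/-- Setting `z = 0` identifies the two quotient rings, so regularity transfers. -/
lemma isWeaklyRegular_quotient_sup_span {rs : List (MvPolynomial {v : V // v ∉ ({z} : Set V)} K)}
    (h : IsWeaklyRegular (MvPolynomial {v : V // v ∉ ({z} : Set V)} K ⧸ I) rs) :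
    IsWeaklyRegular (MvPolynomial V K ⧸ (I.map (inclVars K z) ⊔ Ideal.span {X z}))
      (rs.map (inclVars K z)) := by
  let F : (MvPolynomial {v : V // v ∉ ({z} : Set V)} K ⧸ I) →+*
      (MvPolynomial V K ⧸ (I.map (inclVars K z) ⊔ Ideal.span {X z})) :=
    Ideal.quotientMap _ (inclVars K z).toRingHom (Ideal.map_le_iff_le_comap.mp le_sup_left)
  have hF : Function.Bijective F := by
    constructor
    · refine Ideal.quotientMap_injective' fun f hf => ?_
      exact (inclVars_mem_sup_span_iff z I).mp hf
    · intro y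
      obtain ⟨f, rfl⟩ := Ideal.Quotient.mk_surjective y
      refine ⟨Ideal.Quotient.mk _ (evalZero K z f), ?_⟩
      rw [eq_comm]
      exact (Ideal.Quotient.eq.mpr (Ideal.mem_sup_right (sub_mem_span_X z f)))
  refine ((RingEquiv.ofBijective F hF).toAddEquiv.isWeaklyRegular_congr ?_).mp h
  rw [List.forall₂_map_right_iff, List.forall₂_same]
  intro r _ x
  obtain ⟨f, rfl⟩ := Ideal.Quotient.mk_surjective x
  exact map_mul F (Ideal.Quotient.mk _ r) (Ideal.Quotient.mk _ f)

open Classical in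
/-- Adjoining `z` to the other elements. -/
noncomputable def optionEquivCompl (z : V) : Option {v : V // v ∉ ({z} : Set V)} ≃ V :=
  (Equiv.optionCongr (Equiv.subtypeEquivRight (by simp))).trans (Equiv.optionSubtypeNe z)

/-- A polynomial ring as a ring of polynomials in the variable `z`. -/
noncomputable def polynomialEquiv (K : Type*) [Field K] (z : V) : MvPolynomial V K ≃ₐ[K]
    Polynomial (MvPolynomial {v : V // v ∉ ({z} : Set V)} K) :=
  (renameEquiv K (optionEquivCompl z).symm).trans (optionEquivLeft K _)

lemma polynomialEquiv_X : polynomialEquiv K z (X z) = Polynomial.X := by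
  have : (optionEquivCompl z).symm z = none := by
    rw [Equiv.symm_apply_eq]; simp [optionEquivCompl]
  simp [polynomialEquiv, this]

lemma polynomialEquiv_inclVars (f) :
    polynomialEquiv K z (inclVars K z f) = Polynomial.C f := by
  have : ((polynomialEquiv K z).toAlgHom.comp (inclVars K z)) = Polynomial.CAlgHom := by
    refine MvPolynomial.algHom_ext fun v => ?_
    have : (optionEquivCompl z).symm v.1 = some v := by
      rw [Equiv.symm_apply_eq]; simp [optionEquivCompl]
    simp [polynomialEquiv, this]
  exact DFunLike.congr_fun this f

lemma map_polynomialEquiv_map_inclVars :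
    (I.map (inclVars K z)).map (polynomialEquiv K z) = I.map Polynomial.C := by
  refine (Ideal.map_map (inclVars K z).toRingHom (polynomialEquiv K z).toRingEquiv.toRingHom).trans
    (congrArg (fun F => I.map F) ?_)
  exact RingHom.ext (polynomialEquiv_inclVars z)

lemma mem_map_inclVars_iff {f} :
    f ∈ I.map (inclVars K z) ↔ polynomialEquiv K z f ∈ I.map Polynomial.C := by
  rw [← map_polynomialEquiv_map_inclVars, Ideal.mem_map_of_equiv]
  simp

/-- Membership in an extended ideal is tested on the coefficients of powers of `z`, and
multiplication by `z` only shifts them. -/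
lemma X_mul_mem_map_inclVars_iff {f} :
    X z * f ∈ I.map (inclVars K z) ↔ f ∈ I.map (inclVars K z) := by
  refine ⟨fun h => ?_, Ideal.mul_mem_left _ _⟩
  rw [mem_map_inclVars_iff, map_mul, polynomialEquiv_X, Ideal.mem_map_C_iff] at *
  intro n
  simpa using h (n + 1)

lemma ringKrullDim_quotient_map_inclVars [Finite V] :
    ringKrullDim (MvPolynomial V K ⧸ I.map (inclVars K z)) =
      ringKrullDim (MvPolynomial {v : V // v ∉ ({z} : Set V)} K ⧸ I) + 1 := by
  rw [← Polynomial.ringKrullDim_of_isNoetherianRing]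
  refine ringKrullDim_eq_of_ringEquiv ((Ideal.quotientEquiv _ (I.map Polynomial.C)
    (polynomialEquiv K z).toRingEquiv ?_).trans
    (Ideal.polynomialQuotientEquivQuotientPolynomial I).symm)
  exact (map_polynomialEquiv_map_inclVars z I).symm

end Extension

end PolynomialExtensions

open RingTheory.Sequence Pointwise
open MvPolynomial

/-! ### Primes over monomial ideals -/

section MonomialPrimes

variable {σ K : Type*} [Field K]

/-- Every prime ideal that contains `I` contains a prime ideal that contains `I` and is generated
by variables. -/
def PrimesContainVars (I : Ideal (MvPolynomial σ K)) : Prop :=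
  ∀ P : Ideal (MvPolynomial σ K), P.IsPrime → I ≤ P →
    I ≤ Ideal.span (X '' {v | (X v : MvPolynomial σ K) ∈ P})

lemma PrimesContainVars.sup {I J : Ideal (MvPolynomial σ K)} (hI : PrimesContainVars I)
    (hJ : PrimesContainVars J) : PrimesContainVars (I ⊔ J) := fun P hP h =>
  sup_le (hI P hP (le_sup_left.trans h)) (hJ P hP (le_sup_right.trans h))

lemma primesContainVars_span {S : Set (MvPolynomial σ K)}
    (h : ∀ f ∈ S, ∀ P : Ideal (MvPolynomial σ K), P.IsPrime → f ∈ P →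
      f ∈ Ideal.span (X '' {v | (X v : MvPolynomial σ K) ∈ P})) :
    PrimesContainVars (Ideal.span S) := fun P hP hS =>
  Ideal.span_le.mpr fun f hf => h f hf P hP (hS (Ideal.subset_span hf))

lemma X_mem_span_of_mem {P : Ideal (MvPolynomial σ K)} {v : σ}
    (h : (X v : MvPolynomial σ K) ∈ P) :
    (X v : MvPolynomial σ K) ∈ Ideal.span (X '' {v | (X v : MvPolynomial σ K) ∈ P}) :=
  Ideal.subset_span ⟨v, h, rfl⟩

lemma X_pow_mem_span_of_mem {P : Ideal (MvPolynomial σ K)} (hP : P.IsPrime) {v : σ} {n : ℕ}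
    (hn : 0 < n) (h : (X v ^ n : MvPolynomial σ K) ∈ P) :
    (X v ^ n : MvPolynomial σ K) ∈ Ideal.span (X '' {v | (X v : MvPolynomial σ K) ∈ P}) :=
  Ideal.pow_mem_of_mem _ (X_mem_span_of_mem (hP.mem_of_pow_mem n h)) n hn

end MonomialPrimes

/-! ### Dimension when one block of variables is nilpotent -/

section DisjointVars

variable {K α β σ : Type*} [Field K]

lemma ringKrullDim_quotient_le_of_primes {R : Type*} [CommRing R] {I J : Ideal R}
    (h : ∀ P : Ideal R, P.IsPrime → I ≤ P → J ≤ P) :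
    ringKrullDim (R ⧸ I) ≤ ringKrullDim (R ⧸ J) := by
  have hJ : J ≤ I.radical := by
    rw [Ideal.radical_eq_sInf]
    exact le_sInf fun P hP => h P hP.2 hP.1
  rw [ringKrullDim_quotient, ringKrullDim_quotient, ← PrimeSpectrum.zeroLocus_radical I]
  exact Order.krullDim_le_of_strictMono
    (Set.inclusion (PrimeSpectrum.zeroLocus_anti_mono_ideal hJ)) fun _ _ h => h

/-- Primes see `Q` only through its radical, so all `β`-variables may be killed; what remains is an
image of `MvPolynomial α K ⧸ I`. -/
lemma ringKrullDim_quotient_sup_map_rename_le (e : α ⊕ β ≃ σ) (I : Ideal (MvPolynomial α K))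
    (Q : Ideal (MvPolynomial β K)) (hQ : varsIdeal β K ≤ Q.radical) :
    ringKrullDim (MvPolynomial σ K ⧸ (I.map (rename (R := K) (e ∘ Sum.inl)) ⊔
      Q.map (rename (R := K) (e ∘ Sum.inr)))) ≤ ringKrullDim (MvPolynomial α K ⧸ I) := by
  set J : Ideal (MvPolynomial σ K) := I.map (rename (R := K) (e ∘ Sum.inl)) ⊔
    (varsIdeal β K).map (rename (R := K) (e ∘ Sum.inr)) with hJ
  refine (ringKrullDim_quotient_le_of_primes (J := J) fun P hP h => ?_).trans ?_
  · refine sup_le (le_sup_left.trans h) (Ideal.map_le_iff_le_comap.mpr (hQ.trans ?_))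
    have := hP.comap (rename (R := K) (e ∘ Sum.inr))
    rw [this.radical_le_iff]
    exact Ideal.map_le_iff_le_comap.mp (le_sup_right.trans h)
  · refine ringKrullDim_le_of_surjective (Ideal.quotientMap J (rename (R := K)
      (e ∘ Sum.inl)).toRingHom (Ideal.map_le_iff_le_comap.mp le_sup_left)) fun y => ?_
    obtain ⟨f, rfl⟩ := Ideal.Quotient.mk_surjective y
    let ψ : MvPolynomial σ K →ₐ[K] MvPolynomial α K :=
      aeval fun s => Sum.elim X (fun _ => 0) (e.symm s)
    have hψ : (Ideal.Quotient.mkₐ K J).comp ((rename (R := K) (e ∘ Sum.inl)).comp ψ) =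
        Ideal.Quotient.mkₐ K J := by
      refine MvPolynomial.algHom_ext fun s => ?_
      obtain ⟨s | s, rfl⟩ := e.surjective s
      · simp [ψ]
      · have : (X (e (Sum.inr s)) : MvPolynomial σ K) ∈ J := by
          refine Ideal.mem_sup_right ?_
          simpa using Ideal.mem_map_of_mem (rename (R := K) (e ∘ Sum.inr))
            (X_mem_varsIdeal (K := K) s)
        simpa [ψ] using (Ideal.Quotient.eq_zero_iff_mem.mpr this).symm
    exact ⟨Ideal.Quotient.mk _ (ψ f), DFunLike.congr_fun hψ f⟩

lemma map_rename_varsIdeal_le (a : α → σ) :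
    (varsIdeal α K).map (rename (R := K) a) ≤ varsIdeal σ K := by
  rw [Ideal.map_le_iff_le_comap, varsIdeal, Ideal.span_le]
  rintro _ ⟨v, rfl⟩
  simpa using X_mem_varsIdeal (a v)

end DisjointVars

/-! ### The edge ideal near `z` and the splitting of `J` -/

namespace WeightedOrientedGraph

variable {V : Type*} (K : Type*) [Field K]

lemma X_mul_X_pow_mem_edgeIdeal (D : WeightedOrientedGraph V) {u v : V} (h : D.Arc u v) :
    (X u * X v ^ D.weight v : MvPolynomial V K) ∈ D.edgeIdeal K :=
  Ideal.subset_span ⟨u, v, h, rfl⟩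

lemma edgeIdeal_le_varsIdeal (D : WeightedOrientedGraph V) : D.edgeIdeal K ≤ varsIdeal V K := by
  rw [edgeIdeal, Ideal.span_le]
  rintro _ ⟨u, v, -, rfl⟩
  exact Ideal.mul_mem_right _ _ (X_mem_varsIdeal u)

lemma primesContainVars_edgeIdeal (D : WeightedOrientedGraph V) :
    PrimesContainVars (D.edgeIdeal K) := by
  refine primesContainVars_span ?_
  rintro _ ⟨u, v, -, rfl⟩ P hP h
  rcases hP.mem_or_mem h with h | h
  · exact Ideal.mul_mem_right _ _ (X_mem_span_of_mem h)
  · exact Ideal.mul_mem_left _ _ (X_pow_mem_span_of_mem hP (D.weight_pos v) h)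

variable (H : WeightedOrientedGraph V) (z : V)

lemma edgeIdeal_graphG_le_idealJ : (H.graphG z).edgeIdeal K ≤ H.idealJ K z :=
  le_sup_left.trans le_sup_left

lemma X_mem_idealJ {x : {v : V // v ∉ ({z} : Set V)}} (h : H.Arc x.1 z) :
    (X x : MvPolynomial {v : V // v ∉ ({z} : Set V)} K) ∈ H.idealJ K z :=
  Ideal.mem_sup_left (Ideal.mem_sup_right (Ideal.subset_span ⟨x, h, rfl⟩))

lemma X_pow_mem_idealJ {x : {v : V // v ∉ ({z} : Set V)}} (h : H.Arc z x.1) :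
    (X x ^ H.weight x.1 : MvPolynomial {v : V // v ∉ ({z} : Set V)} K) ∈ H.idealJ K z :=
  Ideal.mem_sup_right (Ideal.subset_span ⟨x, h, rfl⟩)

lemma idealJ_le_iff {I : Ideal (MvPolynomial {v : V // v ∉ ({z} : Set V)} K)} :
    H.idealJ K z ≤ I ↔ (H.graphG z).edgeIdeal K ≤ I ∧
      (∀ x : {v : V // v ∉ ({z} : Set V)}, H.Arc x.1 z → X x ∈ I) ∧
      (∀ x : {v : V // v ∉ ({z} : Set V)}, H.Arc z x.1 → X x ^ H.weight x.1 ∈ I) := by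
  refine ⟨fun h => ⟨(H.edgeIdeal_graphG_le_idealJ K z).trans h,
    fun x hx => h (H.X_mem_idealJ K z hx), fun x hx => h (H.X_pow_mem_idealJ K z hx)⟩, ?_⟩
  rintro ⟨h₁, h₂, h₃⟩
  refine sup_le (sup_le h₁ (Ideal.span_le.mpr ?_)) (Ideal.span_le.mpr ?_)
  · rintro _ ⟨x, hx, rfl⟩
    exact h₂ x hx
  · rintro _ ⟨x, hx, rfl⟩
    exact h₃ x hx

lemma idealJ_le_varsIdeal : H.idealJ K z ≤ varsIdeal _ K :=
  (H.idealJ_le_iff K z).mpr ⟨edgeIdeal_le_varsIdeal K _, fun x _ => X_mem_varsIdeal x,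
    fun x _ => Ideal.pow_mem_of_mem _ (X_mem_varsIdeal x) _ (H.weight_pos _)⟩

lemma primesContainVars_idealJ : PrimesContainVars (H.idealJ K z) := by
  refine ((primesContainVars_edgeIdeal K _).sup (primesContainVars_span ?_)).sup
    (primesContainVars_span ?_)
  · rintro _ ⟨x, -, rfl⟩ P - h
    exact X_mem_span_of_mem h
  · rintro _ ⟨x, -, rfl⟩ P hP h
    exact X_pow_mem_span_of_mem hP (H.weight_pos _) h

/-- An edge at `z` contributes `z` times a generator of `J`; for edges into `z` this uses `w(z) =
1`. -/
lemma edgeIdeal_eq_sup (hz : H.weight z = 1) :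
    H.edgeIdeal K = ((H.graphG z).edgeIdeal K).map (inclVars K z) ⊔
      Ideal.span {X z} * (H.idealJ K z).map (inclVars K z) := by
  apply le_antisymm
  · rw [edgeIdeal, Ideal.span_le]
    rintro _ ⟨u, v, huv, rfl⟩
    by_cases hu : u = z
    · subst hu
      have hv : v ∉ ({u} : Set V) := by
        rintro rfl; exact H.asymm _ _ huv huv
      refine Ideal.mem_sup_right (Ideal.mul_mem_mul (Ideal.mem_span_singleton_self _) ?_)
      simpa using Ideal.mem_map_of_mem (inclVars K u)
        (H.X_pow_mem_idealJ K u (x := ⟨v, hv⟩) huv)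
    · by_cases hv : v = z
      · subst hv
        refine Ideal.mem_sup_right ?_
        rw [hz, pow_one, mul_comm (X u)]
        refine Ideal.mul_mem_mul (Ideal.mem_span_singleton_self _) ?_
        simpa using Ideal.mem_map_of_mem (inclVars K v)
          (H.X_mem_idealJ K v (x := ⟨u, hu⟩) huv)
      · refine Ideal.mem_sup_left ?_
        simpa [deleteVerts] using Ideal.mem_map_of_mem (inclVars K z)
          ((H.graphG z).X_mul_X_pow_mem_edgeIdeal K (u := ⟨u, hu⟩) (v := ⟨v, hv⟩) huv)
  · have hG : ((H.graphG z).edgeIdeal K).map (inclVars K z) ≤ H.edgeIdeal K := by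
      rw [Ideal.map_le_iff_le_comap, edgeIdeal, Ideal.span_le]
      rintro _ ⟨u, v, huv, rfl⟩
      simpa [deleteVerts] using H.X_mul_X_pow_mem_edgeIdeal K (u := u.1) (v := v.1) huv
    refine sup_le hG ?_
    -- The colon ideal of `I(D_H)` by `z`; being an ideal, it need only be checked on generators of
    -- `J`.
    let C : Ideal (MvPolynomial V K) :=
      Submodule.comap (LinearMap.lsmul (MvPolynomial V K) (MvPolynomial V K) (X z))
        (H.edgeIdeal K)
    have hC : (H.idealJ K z).map (inclVars K z) ≤ C := by
      rw [Ideal.map_le_iff_le_comap, idealJ_le_iff]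
      refine ⟨fun f hf => Ideal.mul_mem_left _ _ (hG (Ideal.mem_map_of_mem _ hf)),
        fun x hx => ?_, fun x hx => ?_⟩
      · have := H.X_mul_X_pow_mem_edgeIdeal K hx
        rw [hz, pow_one, mul_comm] at this
        simpa [C] using this
      · simpa [C] using H.X_mul_X_pow_mem_edgeIdeal K hx
    rw [Ideal.span_singleton_mul_le_iff]
    exact fun f hf => hC hf

/-- If `z f = a + z b` with `a` in `GA` and `b` in `JA`, then `z (f - b)` lies in `GA`, hence so
does `f - b`, and `GA ≤ JA`. -/
lemma X_mul_mem_edgeIdeal_iff (hz : H.weight z = 1) (f : MvPolynomial V K) :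
    X z * f ∈ H.edgeIdeal K ↔ f ∈ (H.idealJ K z).map (inclVars K z) := by
  rw [H.edgeIdeal_eq_sup K z hz]
  constructor
  · intro h
    obtain ⟨a, ha, y, hy, h⟩ := Submodule.mem_sup.mp h
    obtain ⟨b, hb, rfl⟩ := Ideal.mem_span_singleton_mul.mp hy
    have hfb : X z * (f - b) ∈ ((H.graphG z).edgeIdeal K).map (inclVars K z) := by
      rwa [mul_sub, ← h, add_sub_cancel_right]
    rw [X_mul_mem_map_inclVars_iff] at hfb
    have := add_mem (Ideal.map_mono (H.edgeIdeal_graphG_le_idealJ K z) hfb) hb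
    rwa [sub_add_cancel] at this
  · exact fun h => Ideal.mem_sup_right (Ideal.mul_mem_mul (Ideal.mem_span_singleton_self _) h)

lemma edgeIdeal_sup_span_X (hz : H.weight z = 1) :
    H.edgeIdeal K ⊔ Ideal.span {X z} =
      ((H.graphG z).edgeIdeal K).map (inclVars K z) ⊔ Ideal.span {X z} := by
  rw [H.edgeIdeal_eq_sup K z hz, sup_assoc]
  exact congrArg _ (sup_eq_right.mpr Ideal.mul_le_left)

open Classical in
/-- The vertices other than `z` are the vertices of `D_F` and the neighbours of `z`. -/
noncomputable def vertsEquiv : {v : V // v ∉ insert z (H.nbrs z)} ⊕ {v : V // v ∈ H.nbrs z} ≃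
    {v : V // v ∉ ({z} : Set V)} where
  toFun := Sum.elim (fun v => ⟨v.1, fun h => v.2 (Or.inl h)⟩)
    (fun v => ⟨v.1, fun h => H.toSimpleGraph.ne_of_adj v.2 h.symm⟩)
  invFun v := if h : v.1 ∈ H.nbrs z then Sum.inr ⟨v.1, h⟩
    else Sum.inl ⟨v.1, fun h' => h'.elim v.2 h⟩
  left_inv := by
    rintro (v | v)
    · have : v.1 ∉ H.nbrs z := fun h => v.2 (Or.inr h)
      simp [this]
    · simp
  right_inv v := by
    by_cases h : v.1 ∈ H.nbrs z <;> simp [h]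

/-- The part of the ideal `J` in the neighbours of `z`. -/
noncomputable def nbrsIdeal : Ideal (MvPolynomial {v : V // v ∈ H.nbrs z} K) :=
  Ideal.span {f | ∃ x : {v : V // v ∈ H.nbrs z}, H.Arc x.1 z ∧ f = X x} ⊔
    Ideal.span {f | ∃ x : {v : V // v ∈ H.nbrs z}, H.Arc z x.1 ∧ f = X x ^ H.weight x.1}

lemma X_mem_nbrsIdeal {x : {v : V // v ∈ H.nbrs z}} (h : H.Arc x.1 z) :
    (X x : MvPolynomial {v : V // v ∈ H.nbrs z} K) ∈ H.nbrsIdeal K z :=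
  Ideal.mem_sup_left (Ideal.subset_span ⟨x, h, rfl⟩)

lemma X_pow_mem_nbrsIdeal {x : {v : V // v ∈ H.nbrs z}} (h : H.Arc z x.1) :
    (X x ^ H.weight x.1 : MvPolynomial {v : V // v ∈ H.nbrs z} K) ∈ H.nbrsIdeal K z :=
  Ideal.mem_sup_right (Ideal.subset_span ⟨x, h, rfl⟩)

lemma varsIdeal_le_radical_nbrsIdeal :
    varsIdeal {v : V // v ∈ H.nbrs z} K ≤ (H.nbrsIdeal K z).radical := by
  rw [varsIdeal, Ideal.span_le]
  rintro _ ⟨x, rfl⟩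
  rcases x.2 with h | h
  · exact ⟨H.weight x.1, H.X_pow_mem_nbrsIdeal K z h⟩
  · exact Ideal.le_radical (H.X_mem_nbrsIdeal K z h)

/-- Modulo the neighbour generators, only edges of `D_F` should survive. The one obstruction is an
edge from some `x_j`, `j > s`, into `D_F`: it carries only the first power of `x_j`, and the
orientation hypothesis excludes it. -/
lemma idealJ_eq_sup (horient : ∀ v x : V, v ∉ insert z (H.nbrs z) → H.Arc z x →
      H.toSimpleGraph.Adj v x → H.Arc v x) :
    H.idealJ K z =
      ((H.graphF z).edgeIdeal K).map (rename (R := K) (H.vertsEquiv z ∘ Sum.inl)) ⊔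
        (H.nbrsIdeal K z).map (rename (R := K) (H.vertsEquiv z ∘ Sum.inr)) := by
  have hX (x : {v : V // v ∉ ({z} : Set V)}) (h : H.Arc x.1 z) :
      (X x : MvPolynomial _ K) ∈
        (H.nbrsIdeal K z).map (rename (R := K) (H.vertsEquiv z ∘ Sum.inr)) := by
    simpa [vertsEquiv] using Ideal.mem_map_of_mem (rename (R := K) (H.vertsEquiv z ∘ Sum.inr))
      (H.X_mem_nbrsIdeal K z (x := ⟨x.1, Or.inr h⟩) h)
  have hXw (x : {v : V // v ∉ ({z} : Set V)}) (h : H.Arc z x.1) :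
      (X x ^ H.weight x.1 : MvPolynomial _ K) ∈
        (H.nbrsIdeal K z).map (rename (R := K) (H.vertsEquiv z ∘ Sum.inr)) := by
    simpa [vertsEquiv] using Ideal.mem_map_of_mem (rename (R := K) (H.vertsEquiv z ∘ Sum.inr))
      (H.X_pow_mem_nbrsIdeal K z (x := ⟨x.1, Or.inl h⟩) h)
  apply le_antisymm
  · rw [idealJ_le_iff]
    refine ⟨?_, fun x hx => Ideal.mem_sup_right (hX x hx),
      fun x hx => Ideal.mem_sup_right (hXw x hx)⟩
    rw [edgeIdeal, Ideal.span_le]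
    rintro _ ⟨u, v, huv, rfl⟩
    by_cases hv : v.1 ∈ H.nbrs z
    · refine Ideal.mem_sup_right (Ideal.mul_mem_left _ _ ?_)
      -- The head carries its full weight, so its factor already lies in the neighbour ideal,
      -- wherever the tail is.
      rcases hv with h | h
      · exact hXw v h
      · exact Ideal.pow_mem_of_mem _ (hX v h) _ (H.weight_pos _)
    · have hv' : v.1 ∉ insert z (H.nbrs z) := fun h => h.elim v.2 hv
      by_cases hu : u.1 ∈ H.nbrs z
      · rcases hu with h | h
        · exact absurd (horient v.1 u.1 hv' h (Or.inr huv)) (H.asymm _ _ huv)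
        · exact Ideal.mem_sup_right (Ideal.mul_mem_right _ _ (hX u h))
      · have hu' : u.1 ∉ insert z (H.nbrs z) := fun h => h.elim u.2 hu
        refine Ideal.mem_sup_left ?_
        simpa [vertsEquiv, deleteVerts] using
          Ideal.mem_map_of_mem (rename (R := K) (H.vertsEquiv z ∘ Sum.inl))
          ((H.graphF z).X_mul_X_pow_mem_edgeIdeal K (u := ⟨u, hu'⟩) (v := ⟨v, hv'⟩) huv)
  · rw [sup_le_iff, Ideal.map_le_iff_le_comap, Ideal.map_le_iff_le_comap, edgeIdeal, Ideal.span_le,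
      nbrsIdeal, sup_le_iff, Ideal.span_le, Ideal.span_le]
    refine ⟨?_, ?_, ?_⟩
    · rintro _ ⟨u, v, huv, rfl⟩
      refine H.edgeIdeal_graphG_le_idealJ K z ?_
      simpa [vertsEquiv, deleteVerts] using
        (H.graphG z).X_mul_X_pow_mem_edgeIdeal K (u := H.vertsEquiv z (Sum.inl u))
          (v := H.vertsEquiv z (Sum.inl v)) huv
    · rintro _ ⟨x, hx, rfl⟩
      simpa using H.X_mem_idealJ K z (x := H.vertsEquiv z (Sum.inr x)) hx
    · rintro _ ⟨x, hx, rfl⟩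
      simpa [vertsEquiv] using H.X_pow_mem_idealJ K z (x := H.vertsEquiv z (Sum.inr x)) hx

end WeightedOrientedGraph

/-! ### Dimension count and conclusion -/

/-- For both ideals dimension plus height equals the number of variables, so a rise in height is a
drop in dimension. -/
lemma ringKrullDim_quotient_add_one_eq {σ K : Type*} [Field K] [Finite σ]
    {I J : Ideal (MvPolynomial σ K)} (hI : I ≠ ⊤) (hJ : J ≠ ⊤) (hI' : PrimesContainVars I)
    (hJ' : PrimesContainVars J) (h : J.height = I.height + 1) :
    ringKrullDim (MvPolynomial σ K ⧸ J) + 1 = ringKrullDim (MvPolynomial σ K ⧸ I) := by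
  have key {I : Ideal (MvPolynomial σ K)} (hI : I ≠ ⊤) (hI' : PrimesContainVars I) :
      ringKrullDim (MvPolynomial σ K ⧸ I) + I.height = Nat.card σ := by
    have : Nontrivial (MvPolynomial σ K ⧸ I) := Ideal.Quotient.nontrivial_iff.mpr hI
    refine le_antisymm ((ringKrullDim_quotient_add_height_le I).trans ?_)
      (card_le_ringKrullDim_add_height hI hI')
    simp [MvPolynomial.ringKrullDim_of_isNoetherianRing, ringKrullDim_eq_zero_of_field]
  have h₁ := key hI hI'
  have h₂ := key hJ hJ'
  obtain ⟨n, hn⟩ := ENat.ne_top_iff_exists.mp (Ideal.height_ne_top hI)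
  rw [h, ← h₁, ← hn, WithBot.coe_add, add_comm (WithBot.some (n : ℕ∞)), ← add_assoc] at h₂
  -- Cancellation is legitimate because the height `n` is finite.
  have hcancel (a b : WithBot ℕ∞) (hab : a + ((n : ℕ∞) : WithBot ℕ∞) = b + (n : ℕ∞)) :
      a = b := by
    induction a <;> induction b
    · rfl
    · rw [WithBot.bot_add, ← WithBot.coe_add] at hab
      exact absurd hab WithBot.bot_ne_coe
    · rw [WithBot.bot_add, ← WithBot.coe_add] at hab
      exact absurd hab WithBot.coe_ne_bot
    · rw [← WithBot.coe_add, ← WithBot.coe_add, WithBot.coe_inj] at hab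
      exact congrArg _ (ENat.add_left_injective_of_ne_top (ENat.natCast_ne_top n) hab)
  exact hcancel _ _ h₂

lemma ringKrullDim_quotient_sup_span_le {K V : Type*} [Field K] (z : V)
    (I : Ideal (MvPolynomial {v : V // v ∉ ({z} : Set V)} K)) :
    ringKrullDim (MvPolynomial V K ⧸ (I.map (inclVars K z) ⊔ Ideal.span {X z})) ≤
      ringKrullDim (MvPolynomial {v : V // v ∉ ({z} : Set V)} K ⧸ I) := by
  refine ringKrullDim_le_of_surjective (Ideal.quotientMap _ (inclVars K z).toRingHom
    (Ideal.map_le_iff_le_comap.mp le_sup_left)) fun y => ?_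
  obtain ⟨f, rfl⟩ := Ideal.Quotient.mk_surjective y
  refine ⟨Ideal.Quotient.mk _ (evalZero K z f), ?_⟩
  rw [eq_comm]
  exact Ideal.Quotient.eq.mpr (Ideal.mem_sup_right (sub_mem_span_X z f))

theorem proposition3p11 {K V : Type*} [Field K] [Finite V]
    (H : WeightedOrientedGraph V) (z : V) (hz : H.weight z = 1)
    -- `{x₁, …, x_k}` is not contained in any minimal vertex cover of `D_G`
    (hcover : ∀ C : Set {v : V // v ∉ ({z} : Set V)},
      Minimal (H.graphG z).toSimpleGraph.IsVertexCover C →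
        ¬ {x : {v : V // v ∉ ({z} : Set V)} | x.1 ∈ H.nbrs z} ⊆ C)
    (hheight : (H.idealJ K z).height = ((H.graphG z).edgeIdeal K).height + 1)
    -- edges between a vertex `v` of `D_F` and some `x_j` with `(z, x_j)` an edge point to `x_j`
    (horient : ∀ v x : V, v ∉ insert z (H.nbrs z) → H.Arc z x →
      H.toSimpleGraph.Adj v x → H.Arc v x)
    (hF : (H.graphF z).IsCohenMacaulay K)
    (hG : (H.graphG z).IsCohenMacaulay K) :
    H.IsCohenMacaulay K := by
  set G := (H.graphG z).edgeIdeal K with hGdef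
  set J := H.idealJ K z with hJdef
  have hGm : G ≤ varsIdeal _ K := WeightedOrientedGraph.edgeIdeal_le_varsIdeal K _
  have hJm : J ≤ varsIdeal _ K := H.idealJ_le_varsIdeal K z
  have hGtop : G ≠ ⊤ := ne_top_of_le_ne_top varsIdeal_ne_top hGm
  have hJtop : J ≠ ⊤ := ne_top_of_le_ne_top varsIdeal_ne_top hJm
  obtain ⟨d, hd, rsG, hrsG, hrsGm, hrsGreg⟩ := hG.exists_hasRegularSequence hGm
  obtain ⟨e, he, rsF, hrsF, hrsFm, hrsFreg⟩ := hF.exists_hasRegularSequence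
    (WeightedOrientedGraph.edgeIdeal_le_varsIdeal K _)
  have hJeq := H.idealJ_eq_sup K z horient
  have hdim : ringKrullDim (MvPolynomial _ K ⧸ J) + 1 = d := by
    rw [← hd]
    exact ringKrullDim_quotient_add_one_eq hGtop hJtop
      (WeightedOrientedGraph.primesContainVars_edgeIdeal K _) (H.primesContainVars_idealJ K z)
      hheight
  have hde : d ≤ e + 1 := by
    have h : ringKrullDim (MvPolynomial _ K ⧸ J) ≤ e := by
      rw [← he, hJdef, hJeq]
      exact ringKrullDim_quotient_sup_map_rename_le _ _ _ (H.varsIdeal_le_radical_nbrsIdeal K z)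
    have h' : ((d : ℕ) : WithBot ℕ∞) ≤ ((e + 1 : ℕ) : WithBot ℕ∞) := by
      rw [← hdim]
      push_cast
      gcongr
    exact_mod_cast h'
  have hmap {I : Ideal (MvPolynomial {v : V // v ∉ ({z} : Set V)} K)} (hI : I ≤ varsIdeal _ K) :
      I.map (inclVars K z) ≤ varsIdeal V K :=
    (Ideal.map_mono hI).trans (map_rename_varsIdeal_le _)
  have hsup {I : Ideal (MvPolynomial {v : V // v ∉ ({z} : Set V)} K)} (hI : I ≤ varsIdeal _ K) :
      I.map (inclVars K z) ⊔ Ideal.span {X z} ≤ varsIdeal V K :=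
    sup_le (hmap hI) ((Ideal.span_singleton_le_iff_mem _).mpr (X_mem_varsIdeal z))
  have hmem {α β : Type _} (a : α → β) {rs : List (MvPolynomial α K)}
      (hrs : ∀ r ∈ rs, r ∈ varsIdeal α K) :
      ∀ r ∈ rs.map (rename (R := K) a), r ∈ varsIdeal β K := by
    intro r hr
    obtain ⟨s, hs, rfl⟩ := List.mem_map.mp hr
    exact map_rename_varsIdeal_le a (Ideal.mem_map_of_mem _ (hrs s hs))
  have hregG : HasRegularSequence (varsIdeal V K)
      (MvPolynomial V K ⧸ (H.edgeIdeal K ⊔ Ideal.span {X z})) d := by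
    rw [H.edgeIdeal_sup_span_X K z hz]
    exact ⟨rsG.map (inclVars K z), by simpa using hrsG, hmem _ hrsGm,
      IsWeaklyRegular.isRegular_quotient (hsup hGm) varsIdeal_ne_top (hmem _ hrsGm)
        (isWeaklyRegular_quotient_sup_span z G hrsGreg.1)⟩
  have hregJ : HasRegularSequence (varsIdeal V K)
      (MvPolynomial V K ⧸ J.map (inclVars K z)) (e + 1) := by
    have h := isWeaklyRegular_quotient_sup_map_rename (H.vertsEquiv z) _ (H.nbrsIdeal K z)
      hrsFreg.1
    rw [← hJeq] at h
    have hm := hmem (H.vertsEquiv z ∘ Sum.inl) hrsFm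
    -- Putting `z` first is convenient: it is regular modulo `JA`, and dividing by it returns to
    -- `A_{D_G}/J`, where the sequence from `D_F` is regular.
    have hm' : ∀ r ∈ X z :: (rsF.map (rename (H.vertsEquiv z ∘ Sum.inl))).map (inclVars K z),
        r ∈ varsIdeal V K := List.forall_mem_cons.mpr ⟨X_mem_varsIdeal z, hmem _ hm⟩
    refine ⟨_, by simp [hrsF], hm',
      IsWeaklyRegular.isRegular_quotient (hmap hJm) varsIdeal_ne_top hm' ?_⟩
    rw [isWeaklyRegular_cons_iff, (quotSMulTopQuotientEquiv _ _).isWeaklyRegular_congr]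
    refine ⟨?_, isWeaklyRegular_quotient_sup_span z J h⟩
    rw [isSMulRegular_quotient_iff_mem_of_smul_mem]
    exact fun f hf => (X_mul_mem_map_inclVars_iff z J).mp hf
  refine IsCohenMacaulayQuotient.of_hasRegularSequence (n := d) ?_ ?_
  · refine ringKrullDim_quotient_le_of_mul_le (I₁ := H.edgeIdeal K ⊔ Ideal.span {X z})
      (I₂ := J.map (inclVars K z)) ?_ ?_ ?_
    · rw [Ideal.sup_mul, sup_le_iff, Ideal.span_singleton_mul_le_iff]
      exact ⟨Ideal.mul_le_left, fun f hf => (H.X_mul_mem_edgeIdeal_iff K z hz f).mpr hf⟩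
    · rw [H.edgeIdeal_sup_span_X K z hz, ← hd]
      exact ringKrullDim_quotient_sup_span_le z G
    -- The extra variable `z` makes up for the drop by one from `G` to `J`.
    · rw [ringKrullDim_quotient_map_inclVars, hdim]
  · have hlt := smul_top_quotient_lt_top (hmap hJm) varsIdeal_ne_top
    exact HasRegularSequence.of_colon varsIdeal_ne_top
      (WeightedOrientedGraph.edgeIdeal_le_varsIdeal K H) (hmap hJm) (X_mem_varsIdeal z)
      (H.X_mul_mem_edgeIdeal_iff K z hz) (hregJ.mono hlt hde) hregG
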